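/- Let $\rho_{AB}$ be a two-qubit state, i.e. a positive semidefinite operator of trace one on $\mathbb{C}^2\otimes\mathbb{C}^2$. A family of POVMs $\{M_{a|x}\}_a$ on Alice's qubit (arbitrary inputs $x$, finitely many outcomes $a$ for each input) turns $\rho_{AB}$ into the assemblage $\mathcal{A}=\{\sigma_{a|x}\}$, $\sigma_{a|x}=\mathrm{Tr}_A[(M_{a|x}\otimes\mathbb{I})\rho_{AB}]$. An assemblage is simulated with shared randomness of size $n$ if there are a probability distribution $p(i)>0$ on $i\in\{1,\dots,n\}$, states $\rho_1,\dots,\rho_n$ of Bob's qubit, and conditional probability distributions $p(a|x,i)$ such that $\sigma_{a|x}=\sum_{i=1}^n p(a|x,i)\,p(i)\,\rho_i$ for all $a,x$. Let $\gamma(\rho_{AB})\in[1,+\infty]$ be the smallest $n$ such that every assemblage obtained from $\rho_{AB}$ in this way can be simulated with shared randomness of size $n$, with $\gamma(\rho_{AB})=+\infty$ if no finite $n$ suffices (in particular if $\rho_{AB}$ is steerable). Then $\rho_{AB}$ is entangled (not a finite convex combination of product states) if and only if $\gamma(\rho_{AB})>4$. In particular, this holds for every unsteerable two-qubit state. -/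

import Mathlib

open scoped ComplexOrder Kronecker

noncomputable section

namespace Steering

variable {A B : Type} [Fintype A] [DecidableEq A] [Fintype B] [DecidableEq B]

/-- A quantum state (density operator): a positive semidefinite complex matrix of trace one. -/
structure IsState {S : Type} [Fintype S] (ρ : Matrix S S ℂ) : Prop where
  posSemidef : ρ.PosSemidef
  trace_eq_one : ρ.trace = 1

/-- A POVM with `k` outcomes: positive semidefinite effects that sum to the identity. -/
structure IsPOVM {k : ℕ} (M : Fin k → Matrix A A ℂ) : Prop where
  posSemidef : ∀ a, (M a).PosSemidef
  sum_eq_one : ∑ a, M a = 1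

/-- A bipartite operator is separable if it is a finite convex combination of
product states. -/
def IsSeparable (ρ : Matrix (A × B) (A × B) ℂ) : Prop :=
  ∃ (m : ℕ) (p : Fin m → ℝ) (α : Fin m → Matrix A A ℂ) (β : Fin m → Matrix B B ℂ),
    (∀ i, 0 ≤ p i) ∧ ∑ i, p i = 1 ∧ (∀ i, IsState (α i)) ∧ (∀ i, IsState (β i)) ∧
      ρ = ∑ i, p i • (α i ⊗ₖ β i)

/-- A bipartite state is entangled if it is not separable. -/
def IsEntangled (ρ : Matrix (A × B) (A × B) ℂ) : Prop :=
  IsState ρ ∧ ¬ IsSeparable ρ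

/-- The partial trace `Tr_A` over the first party. -/
def partialTraceA (ρ : Matrix (A × B) (A × B) ℂ) : Matrix B B ℂ :=
  Matrix.of fun b b' => ∑ a, ρ (a, b) (a, b')

/-- The unnormalised state `Tr_A[(M ⊗ I) ρ]` to which Bob is steered by Alice's effect `M`. -/
def steered (ρ : Matrix (A × B) (A × B) ℂ) (M : Matrix A A ℂ) : Matrix B B ℂ :=
  partialTraceA ((M ⊗ₖ (1 : Matrix B B ℂ)) * ρ)

/-- The relation `ρ ↦ 𝒜`: the assemblage `σ`, with inputs `x : X` and `k x` outcomes for the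
input `x`, arises from `ρ` when Alice performs a POVM for each of her inputs. -/
def Generates (ρ : Matrix (A × B) (A × B) ℂ) {X : Type} {k : X → ℕ}
    (σ : (x : X) → Fin (k x) → Matrix B B ℂ) : Prop :=
  ∃ M : (x : X) → Fin (k x) → Matrix A A ℂ,
    (∀ x, IsPOVM (M x)) ∧ ∀ x a, σ x a = steered ρ (M x a)

/-- The assemblage `σ` has a local hidden state model with shared randomness of size `n`:
a shared variable `i` with distribution `p i > 0`, hidden states `τ i` for Bob, and a
classical channel `q x i a` (the probability of `a` given `x` and `i`) for Alice. -/
def HasLHSModel {X : Type} {k : X → ℕ} (σ : (x : X) → Fin (k x) → Matrix B B ℂ)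
    (n : ℕ) : Prop :=
  ∃ (p : Fin n → ℝ) (τ : Fin n → Matrix B B ℂ) (q : (x : X) → Fin n → Fin (k x) → ℝ),
    (∀ i, 0 < p i) ∧ ∑ i, p i = 1 ∧ (∀ i, IsState (τ i)) ∧
      (∀ x i a, 0 ≤ q x i a) ∧ (∀ x i, ∑ a, q x i a = 1) ∧
      ∀ x a, σ x a = ∑ i, (q x i a * p i) • τ i

/-- Shared randomness of size `n` suffices to simulate every assemblage generated by `ρ`. -/
def Simulable (ρ : Matrix (A × B) (A × B) ℂ) (n : ℕ) : Prop :=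
  ∀ (X : Type) (k : X → ℕ) (σ : (x : X) → Fin (k x) → Matrix B B ℂ),
    Generates ρ σ → HasLHSModel σ n

/-- The shared-randomness simulation cost `γ(ρ)`: the smallest size of shared randomness that
suffices to simulate every assemblage generated by `ρ`, and `⊤` if no finite size suffices. -/
def simulationCost (ρ : Matrix (A × B) (A × B) ℂ) : ℕ∞ :=
  ⨅ (n : ℕ) (_ : Simulable ρ n), (n : ℕ∞)

end Steering

end

/-! Both directions pass through `FourTerm`: being a sum of four products of positive operators. For
trace-one operators this is equivalent to separability, and it yields a simulation with at most four
hidden states.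

Every separable operator is `FourTerm` (`fourTerm_sum`). After adding a small multiple of the
identity, minimise the trace over pairs of local filters of determinant of modulus one. At the
minimum both marginals are multiples of the identity (`fourTerm_of_strict`), so only the correlation
matrix matters. Its nuclear norm is bounded by the scalar part, and its singular value
decomposition, spread over the vertices of a tetrahedron, gives four products
(`fourTerm_of_marginals`). Undoing the filters and a compactness argument finish.

Conversely, let at most four hidden states suffice (`fourTerm_of_simulable`). If they span the
four-dimensional space of matrices, they form a basis, and the coordinates of the steered states are
given by positive operators of Alice. Otherwise all blocks of the state are orthogonal to a
Hermitian `H ≠ 0`. A semidefinite `H` forces a product. An indefinite `H` makes the state, after a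
filter, invariant under partial transposition, and a Schur complement decomposes it. -/

namespace TwoQubit

open Matrix Complex

/-! ### Qubit operators in Bloch coordinates -/

/-- The space of Bloch vectors. -/
abbrev Bloch := EuclideanSpace ℝ (Fin 3)

/-- Complex `2 × 2` matrices, the operators on one qubit. -/
abbrev Mat2 := Matrix (Fin 2) (Fin 2) ℂ

/-- Operators on two qubits. -/
abbrev Mat22 := Matrix (Fin 2 × Fin 2) (Fin 2 × Fin 2) ℂ

/-- The traceless Hermitian matrix `v · σ` with Pauli coordinates `v`. -/
noncomputable def pauli : Bloch →ₗ[ℝ] Mat2 where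
  toFun v := !![(v 2 : ℂ), v 0 - v 1 * I; v 0 + v 1 * I, -v 2]
  map_add' v w := by
    ext i j
    fin_cases i <;> fin_cases j <;> simp <;> ring
  map_smul' c v := by
    ext i j
    fin_cases i <;> fin_cases j <;> simp <;> ring

/-- The Hermitian matrix `t + v · σ`. -/
noncomputable def herm (t : ℝ) (v : Bloch) : Mat2 := t • (1 : Mat2) + pauli v

theorem herm_eq (t : ℝ) (v : Bloch) :
    herm t v = !![(t : ℂ) + v 2, v 0 - v 1 * I; v 0 + v 1 * I, t - v 2] := by
  ext i j
  fin_cases i <;> fin_cases j <;> simp [herm, pauli, sub_eq_add_neg]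

theorem bloch_inner (v w : Bloch) : inner ℝ v w = v 0 * w 0 + v 1 * w 1 + v 2 * w 2 := by
  simp [PiLp.inner_apply, Fin.sum_univ_three]
  ring

theorem bloch_norm_sq (v : Bloch) : ‖v‖ ^ 2 = v 0 ^ 2 + v 1 ^ 2 + v 2 ^ 2 := by
  rw [← real_inner_self_eq_norm_sq, bloch_inner]
  ring

theorem trace_herm_mul_herm (t s : ℝ) (v w : Bloch) :
    (herm t v * herm s w).trace = ((2 * (t * s + inner ℝ v w) : ℝ) : ℂ) := by
  rw [herm_eq, herm_eq, bloch_inner]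
  apply Complex.ext <;> simp [Matrix.trace, Fin.sum_univ_two] <;> ring

theorem trace_herm (t : ℝ) (v : Bloch) : (herm t v).trace = ((2 * t : ℝ) : ℂ) := by
  rw [herm_eq]
  simp [Matrix.trace, Fin.sum_univ_two]
  ring

theorem det_herm (t : ℝ) (v : Bloch) : (herm t v).det = ((t ^ 2 - ‖v‖ ^ 2 : ℝ) : ℂ) := by
  rw [herm_eq, bloch_norm_sq, Matrix.det_fin_two]
  apply Complex.ext <;> simp [pow_two] <;> ring

theorem isHermitian_herm (t : ℝ) (v : Bloch) : (herm t v).IsHermitian := by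
  rw [herm_eq]
  ext i j
  fin_cases i <;> fin_cases j <;> simp [sub_eq_add_neg]

theorem exists_eq_herm {M : Mat2} (hM : M.IsHermitian) : ∃ t v, M = herm t v := by
  refine ⟨((M 0 0).re + (M 1 1).re) / 2,
    !₂[(M 1 0).re, (M 1 0).im, ((M 0 0).re - (M 1 1).re) / 2], ?_⟩
  have h00 := hM.apply 0 0
  have h11 := hM.apply 1 1
  have h01 := hM.apply 0 1
  have h00i := congrArg Complex.im h00
  have h11i := congrArg Complex.im h11
  simp at h00i h11i
  rw [herm_eq]
  ext i j
  fin_cases i <;> fin_cases j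
  · apply Complex.ext
    · simp; ring
    · simp; linarith
  · refine h01.symm.trans ?_
    apply Complex.ext <;> simp
  · apply Complex.ext <;> simp
  · apply Complex.ext
    · simp; ring
    · simp; linarith

theorem posSemidef_herm_iff {t : ℝ} {v : Bloch} : (herm t v).PosSemidef ↔ ‖v‖ ≤ t := by
  constructor
  · intro h
    have h1 := h.trace_nonneg
    have h2 := h.det_nonneg
    rw [trace_herm] at h1
    rw [det_herm] at h2
    have h1' : (0 : ℝ) ≤ 2 * t := by exact_mod_cast h1
    have h2' : (0 : ℝ) ≤ t ^ 2 - ‖v‖ ^ 2 := by exact_mod_cast h2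
    exact abs_le_of_sq_le_sq' (by linarith) (by linarith) |>.2
  · intro h
    refine .of_dotProduct_mulVec_nonneg (isHermitian_herm t v) fun x => ?_
    -- The unnormalised Bloch vector of `x`: its length is the squared norm of `x`, so
    -- Cauchy–Schwarz bounds the quadratic form below.
    set n : Bloch := !₂[2 * ((x 0).re * (x 1).re + (x 0).im * (x 1).im),
      2 * ((x 0).re * (x 1).im - (x 0).im * (x 1).re),
      normSq (x 0) - normSq (x 1)] with hn
    set r : ℝ := normSq (x 0) + normSq (x 1) with hr
    have hr0 : 0 ≤ r := add_nonneg (normSq_nonneg _) (normSq_nonneg _)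
    have hnr : ‖n‖ = r := by
      rw [← abs_of_nonneg hr0, ← abs_of_nonneg (norm_nonneg n), ← sq_eq_sq_iff_abs_eq_abs,
        bloch_norm_sq]
      simp [hn, hr, normSq_apply]
      ring
    have key : star x ⬝ᵥ (herm t v *ᵥ x) = ((t * r + inner ℝ v n : ℝ) : ℂ) := by
      rw [herm_eq, bloch_inner]
      apply Complex.ext <;>
        simp [hn, hr, dotProduct, mulVec, Fin.sum_univ_two, normSq_apply] <;> ring
    rw [key]
    have h1 := abs_le.mp (abs_real_inner_le_norm v n)
    have h2 : ‖v‖ * ‖n‖ ≤ t * r := by rw [hnr]; gcongr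
    exact_mod_cast (by linarith [h1.1] : 0 ≤ t * r + inner ℝ v n)

theorem exists_herm_of_posSemidef {M : Mat2} (hM : M.PosSemidef) :
    ∃ t v, M = herm t v ∧ ‖v‖ ≤ t := by
  obtain ⟨t, v, rfl⟩ := exists_eq_herm hM.isHermitian
  exact ⟨t, v, rfl, posSemidef_herm_iff.mp hM⟩

theorem exists_smul_herm_of_posSemidef {M : Mat2} (hM : M.PosSemidef) :
    ∃ (t : ℝ) (v : Bloch), M = t • herm 1 v ∧ 0 ≤ t ∧ ‖v‖ ≤ 1 := by
  obtain ⟨t, v, rfl, h⟩ := exists_herm_of_posSemidef hM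
  have ht : 0 ≤ t := (norm_nonneg v).trans h
  rcases ht.eq_or_lt with rfl | ht'
  · have hv : v = 0 := by simpa using h
    exact ⟨0, 0, by simp [hv, herm], le_rfl, by simp⟩
  · refine ⟨t, t⁻¹ • v, ?_, ht, ?_⟩
    · simp [herm, smul_smul, ht'.ne']
    · rw [norm_smul, Real.norm_of_nonneg (inv_nonneg.mpr ht), inv_mul_le_one₀ ht']
      exact h

/-- Negating the vector gives the adjugate, which is the inverse when the determinant is one. -/
theorem herm_mul_herm_neg {t : ℝ} {v : Bloch} (h : t ^ 2 - ‖v‖ ^ 2 = 1) :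
    herm t v * herm t (-v) = 1 := by
  rw [bloch_norm_sq] at h
  have h' : (t : ℂ) ^ 2 - (v 0 ^ 2 + v 1 ^ 2 + v 2 ^ 2) = 1 := by exact_mod_cast h
  rw [herm_eq, herm_eq]
  ext i j
  fin_cases i <;> fin_cases j <;> simp [Matrix.mul_apply, Fin.sum_univ_two]
  · linear_combination h' + (v 1 : ℂ) ^ 2 * I_sq
  · ring
  · ring
  · linear_combination h' + (v 1 : ℂ) ^ 2 * I_sq

theorem continuous_herm (t : ℝ) : Continuous (herm t) := by
  have h : herm t = fun v => herm t v := rfl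
  rw [h]
  simp only [herm_eq]
  refine continuous_matrix fun i j => ?_
  fin_cases i <;> fin_cases j <;> simp <;> fun_prop

theorem isState_half_herm {v : Bloch} (hv : ‖v‖ ≤ 1) :
    Steering.IsState ((1 / 2 : ℝ) • herm 1 v) where
  posSemidef := (posSemidef_herm_iff.mpr hv).smul (by norm_num)
  trace_eq_one := by
    rw [trace_smul, trace_herm]
    norm_num

/-! ### Sums of four products: closedness and local filters -/

/-- An operator is a sum of four products of positive semidefinite operators. -/
def FourTerm (ρ : Mat22) : Prop :=
  ∃ ω β : Fin 4 → Mat2, (∀ i, (ω i).PosSemidef) ∧ (∀ i, (β i).PosSemidef) ∧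
    ρ = ∑ i, ω i ⊗ₖ β i

theorem FourTerm.exists_weights {ρ : Mat22} (h : FourTerm ρ) :
    ∃ (p : Fin 4 → ℝ) (a b : Fin 4 → Bloch), (∀ i, 0 ≤ p i) ∧ (∀ i, ‖a i‖ ≤ 1) ∧
      (∀ i, ‖b i‖ ≤ 1) ∧ ρ = ∑ i, p i • (herm 1 (a i) ⊗ₖ herm 1 (b i)) := by
  obtain ⟨ω, β, hω, hβ, rfl⟩ := h
  choose s a hs hs0 ha using fun i => exists_smul_herm_of_posSemidef (hω i)
  choose t b ht ht0 hb using fun i => exists_smul_herm_of_posSemidef (hβ i)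
  refine ⟨fun i => s i * t i, a, b, fun i => mul_nonneg (hs0 i) (ht0 i), ha, hb, ?_⟩
  refine Finset.sum_congr rfl fun i _ => ?_
  conv_lhs => rw [hs i, ht i]
  rw [smul_kronecker, kronecker_smul, smul_smul]

theorem fourTerm_of_weights {p : Fin 4 → ℝ} {a b : Fin 4 → Bloch} (hp : ∀ i, 0 ≤ p i)
    (ha : ∀ i, ‖a i‖ ≤ 1) (hb : ∀ i, ‖b i‖ ≤ 1) :
    FourTerm (∑ i, p i • (herm 1 (a i) ⊗ₖ herm 1 (b i))) :=
  ⟨fun i => p i • herm 1 (a i), fun i => herm 1 (b i),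
    fun i => (posSemidef_herm_iff.mpr (ha i)).smul (hp i),
    fun i => posSemidef_herm_iff.mpr (hb i), by simp only [smul_kronecker]⟩

theorem trace_sum_weights (p : Fin 4 → ℝ) (a b : Fin 4 → Bloch) :
    (∑ i, p i • (herm 1 (a i) ⊗ₖ herm 1 (b i))).trace = ((4 * ∑ i, p i : ℝ) : ℂ) := by
  simp only [trace_sum, trace_smul, trace_kronecker, trace_herm, Finset.mul_sum, ofReal_sum]
  refine Finset.sum_congr rfl fun i _ => ?_
  simp
  ring

/-- Weights of bounded total and Bloch vectors in the unit ball range over a compact set, so the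
attainable operators form a closed set. This allows perturbing to a nondegenerate operator. -/
theorem fourTerm_of_forall_add_smul_one {ρ : Mat22}
    (h : ∀ ε : ℝ, 0 < ε → FourTerm (ρ + ε • 1)) : FourTerm ρ := by
  -- The weights sum to a quarter of the trace, and `ε • 1` with `ε < 1` adds less than one to that
  -- sum.
  set C : ℝ := ρ.trace.re / 4 + 1
  set K : Set ((Fin 4 → ℝ) × (Fin 4 → Bloch) × (Fin 4 → Bloch)) :=
    (Set.univ.pi fun _ => Set.Icc 0 C) ×ˢ
      ((Set.univ.pi fun _ => Metric.closedBall 0 1) ×ˢ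
        (Set.univ.pi fun _ => Metric.closedBall 0 1))
  have hK : IsCompact K :=
    (isCompact_univ_pi fun _ => isCompact_Icc).prod
      ((isCompact_univ_pi fun _ => isCompact_closedBall _ _).prod
        (isCompact_univ_pi fun _ => isCompact_closedBall _ _))
  set F : (Fin 4 → ℝ) × (Fin 4 → Bloch) × (Fin 4 → Bloch) → Mat22 :=
    fun z => ∑ i, z.1 i • (herm 1 (z.2.1 i) ⊗ₖ herm 1 (z.2.2 i))
  have hF : Continuous F := by
    refine continuous_finsetSum _ fun i _ =>
      ((continuous_apply i).comp continuous_fst).smul ?_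
    have h1 : Continuous fun z : (Fin 4 → ℝ) × (Fin 4 → Bloch) × (Fin 4 → Bloch) =>
        herm 1 (z.2.1 i) := (continuous_herm 1).comp (by fun_prop)
    have h2 : Continuous fun z : (Fin 4 → ℝ) × (Fin 4 → Bloch) × (Fin 4 → Bloch) =>
        herm 1 (z.2.2 i) := (continuous_herm 1).comp (by fun_prop)
    refine continuous_matrix fun j k => ?_
    simp only [kroneckerMap_apply]
    exact (h1.matrix_elem _ _).mul (h2.matrix_elem _ _)
  have hclosed : IsClosed (F '' K) := (hK.image hF).isClosed
  have hmem : ρ ∈ F '' K := by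
    have hlim : Filter.Tendsto (fun ε : ℝ => ρ + ε • (1 : Mat22)) (nhdsWithin 0 (Set.Ioi 0))
        (nhds ρ) := by
      have : Continuous fun ε : ℝ => ρ + ε • (1 : Mat22) := by fun_prop
      simpa using (this.tendsto 0).mono_left nhdsWithin_le_nhds
    refine hclosed.mem_of_tendsto hlim ?_
    filter_upwards [Ioo_mem_nhdsGT (zero_lt_one' ℝ)] with ε hε
    obtain ⟨p, a, b, hp, ha, hb, hρ⟩ := (h ε hε.1).exists_weights
    refine ⟨(p, a, b), ⟨fun i _ => ⟨hp i, ?_⟩, fun i _ => by simpa using ha i,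
      fun i _ => by simpa using hb i⟩, hρ.symm⟩
    have htr := congrArg (fun M => (Matrix.trace M).re) hρ
    simp only [trace_sum_weights, ofReal_re, trace_add, trace_smul, trace_one, add_re] at htr
    simp at htr
    have := Finset.single_le_sum (fun j _ => hp j) (Finset.mem_univ i)
    simp only [C]
    linarith [hε.2]
  obtain ⟨⟨p, a, b⟩, ⟨hp, ha, hb⟩, rfl⟩ := hmem
  exact fourTerm_of_weights (fun i => (hp i trivial).1) (fun i => by simpa using ha i trivial)
    (fun i => by simpa using hb i trivial)

theorem FourTerm.conj {ρ : Mat22} (h : FourTerm ρ) (S T : Mat2) :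
    FourTerm ((S ⊗ₖ T) * ρ * (S ⊗ₖ T)ᴴ) := by
  obtain ⟨ω, β, hω, hβ, rfl⟩ := h
  refine ⟨fun i => S * ω i * Sᴴ, fun i => T * β i * Tᴴ,
    fun i => (hω i).mul_mul_conjTranspose_same S, fun i => (hβ i).mul_mul_conjTranspose_same T, ?_⟩
  simp only [Finset.mul_sum, Finset.sum_mul, conjTranspose_kronecker, mul_kronecker_mul]

theorem FourTerm.of_conj {ρ : Mat22} {S T : Mat2} (hS : IsUnit S) (hT : IsUnit T)
    (h : FourTerm ((S ⊗ₖ T) * ρ * (S ⊗ₖ T)ᴴ)) : FourTerm ρ := by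
  obtain ⟨S, rfl⟩ := hS
  obtain ⟨T, rfl⟩ := hT
  have key := h.conj (↑S⁻¹ : Mat2) (↑T⁻¹ : Mat2)
  have h1 : ((↑S⁻¹ : Mat2) ⊗ₖ (↑T⁻¹ : Mat2)) * ((S : Mat2) ⊗ₖ (T : Mat2)) = 1 := by
    rw [← mul_kronecker_mul]
    simp
  have h2 := congrArg conjTranspose h1
  rw [conjTranspose_mul, conjTranspose_one] at h2
  convert key using 1
  set U := (S : Mat2) ⊗ₖ (T : Mat2)
  set V := (↑S⁻¹ : Mat2) ⊗ₖ (↑T⁻¹ : Mat2)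
  calc ρ = (V * U) * ρ * (Uᴴ * Vᴴ) := by rw [h1, h2]; simp
    _ = _ := by simp only [mul_assoc]

/-! ### Identity marginals: singular values and the tetrahedron -/

/-- Singular value decomposition of a linear endomorphism of the Bloch space. -/
theorem exists_singular_value_decomposition (T : Bloch →ₗ[ℝ] Bloch) :
    ∃ (b v : OrthonormalBasis (Fin 3) ℝ Bloch) (s : Fin 3 → ℝ),
      (∀ k, 0 ≤ s k) ∧ ∀ k, T (v k) = s k • b k := by
  have hsym : (T.adjoint ∘ₗ T).IsSymmetric := T.isSymmetric_adjoint_comp_self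
  have hn : Module.finrank ℝ Bloch = 3 := by simp
  set v := hsym.eigenvectorBasis hn with hv
  have horth : ∀ k l, inner ℝ (T (v k)) (T (v l)) =
      hsym.eigenvalues hn l * inner ℝ (v k) (v l) := by
    intro k l
    rw [← LinearMap.adjoint_inner_right, ← LinearMap.comp_apply, hv,
      hsym.apply_eigenvectorBasis hn l, inner_smul_right]
    simp
  set e : Fin 3 → Bloch := fun k => ‖T (v k)‖⁻¹ • T (v k) with he
  -- Images of eigenvectors of `T.adjoint ∘ₗ T` are orthogonal; the nonzero ones are normalised and
  -- extended to a basis.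
  have heo : Orthonormal ℝ (Set.domRestrict {k | T (v k) ≠ 0} e) := by
    constructor
    · rintro ⟨k, hk⟩
      have : ‖T (v k)‖ ≠ 0 := norm_ne_zero_iff.mpr hk
      simp [he, norm_smul, this]
    · rintro ⟨k, hk⟩ ⟨l, hl⟩ hkl
      have hkl' : k ≠ l := fun h => hkl (Subtype.ext h)
      simp [he, inner_smul_left, inner_smul_right, horth, v.orthonormal.2 hkl']
  obtain ⟨b, hb⟩ := heo.exists_orthonormalBasis_extension_of_card_eq (by simp)
  refine ⟨b, v, fun k => ‖T (v k)‖, fun k => norm_nonneg _, fun k => ?_⟩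
  by_cases hk : T (v k) = 0
  · simp [hk]
  · have : ‖T (v k)‖ ≠ 0 := norm_ne_zero_iff.mpr hk
    rw [hb k hk, he]
    simp [smul_smul, this]

/-- The vertices of a regular tetrahedron inscribed in the cube `{±1}³`. -/
def tetrahedron : Fin 4 → Fin 3 → ℝ := ![![1, 1, 1], ![1, -1, -1], ![-1, 1, -1], ![-1, -1, 1]]

theorem sum_tetrahedron (k : Fin 3) : ∑ j, tetrahedron j k = 0 := by
  fin_cases k <;> simp [tetrahedron, Fin.sum_univ_four]

theorem tetrahedron_sq (j : Fin 4) (k : Fin 3) : tetrahedron j k * tetrahedron j k = 1 := by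
  fin_cases j <;> fin_cases k <;> simp [tetrahedron]

theorem sum_tetrahedron_mul (k l : Fin 3) :
    ∑ j, tetrahedron j k * tetrahedron j l = if k = l then 4 else 0 := by
  fin_cases k <;> fin_cases l <;> simp [tetrahedron, Fin.sum_univ_four] <;> norm_num

theorem norm_sum_tetrahedron (b : OrthonormalBasis (Fin 3) ℝ Bloch) {s : Fin 3 → ℝ}
    (hs : ∀ k, 0 ≤ s k) (j : Fin 4) :
    ‖∑ k, (tetrahedron j k * √(s k)) • b k‖ ^ 2 = ∑ k, s k := by
  rw [← real_inner_self_eq_norm_sq, b.orthonormal.inner_sum]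
  refine Finset.sum_congr rfl fun k _ => ?_
  have h := tetrahedron_sq j k
  have h' := Real.mul_self_sqrt (hs k)
  simp only [conj_trivial]
  linear_combination (√(s k) * √(s k)) * h + h'

/-- A correlation matrix that is a positive combination of dyads of Bloch vectors is a combination
of four dyads which sum to zero on either side. -/
theorem exists_four_bloch_vectors {ι : Type*} [Fintype ι] {x y : ι → ℝ} {u z : ι → Bloch}
    (hu : ∀ i, ‖u i‖ ≤ x i) (hz : ∀ i, ‖z i‖ ≤ y i) :
    ∃ a b : Fin 4 → Bloch, (∀ j, ‖a j‖ ≤ √(∑ i, x i * y i)) ∧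
      (∀ j, ‖b j‖ ≤ √(∑ i, x i * y i)) ∧ ∑ j, a j = 0 ∧ ∑ j, b j = 0 ∧
      ∀ (V : Type) [AddCommGroup V] [Module ℝ V] (B : Bloch →ₗ[ℝ] Bloch →ₗ[ℝ] V),
        ∑ i, B (u i) (z i) = ∑ j, (1 / 4 : ℝ) • B (a j) (b j) := by
  set T : Bloch →ₗ[ℝ] Bloch := ∑ i, (innerₛₗ ℝ (z i)).smulRight (u i) with hT
  have hTv : ∀ v, T v = ∑ i, inner ℝ (z i) v • u i := fun v => by simp [hT]
  obtain ⟨b, v, s, hs, hsvd⟩ := exists_singular_value_decomposition T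
  -- The nuclear norm of a sum of dyads is at most the sum of the products of the norms.
  have hsum : ∑ k, s k ≤ ∑ i, x i * y i := by
    have h1 : ∀ k, s k = ∑ i, inner ℝ (b k) (u i) * inner ℝ (v k) (z i) := fun k => by
      have h2 : inner ℝ (b k) (T (v k)) = s k := by
        rw [hsvd, inner_smul_right, real_inner_self_eq_norm_sq, b.orthonormal.1]
        simp
      rw [← h2, hTv, inner_sum]
      refine Finset.sum_congr rfl fun i _ => ?_
      rw [inner_smul_right, real_inner_comm (v k) (z i)]
      ring
    rw [Finset.sum_congr rfl fun k _ => h1 k, Finset.sum_comm]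
    refine Finset.sum_le_sum fun i _ => ?_
    refine (Real.sum_mul_le_sqrt_mul_sqrt _ _ _).trans ?_
    have h3 : ∀ (c : OrthonormalBasis (Fin 3) ℝ Bloch) w, √(∑ k, inner ℝ (c k) w ^ 2) = ‖w‖ := by
      intro c w
      have := c.sum_sq_norm_inner_right w
      simp only [Real.norm_eq_abs, sq_abs] at this
      rw [this, Real.sqrt_sq (norm_nonneg w)]
    rw [h3, h3]
    exact mul_le_mul (hu i) (hz i) (norm_nonneg _) ((norm_nonneg _).trans (hu i))
  have hzero : ∀ c : OrthonormalBasis (Fin 3) ℝ Bloch,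
      ∑ j, ∑ k, (tetrahedron j k * √(s k)) • c k = 0 := by
    intro c
    rw [Finset.sum_comm]
    simp only [← Finset.sum_smul, ← Finset.sum_mul, sum_tetrahedron, zero_mul, zero_smul,
      Finset.sum_const_zero]
  refine ⟨fun j => ∑ k, (tetrahedron j k * √(s k)) • b k,
    fun j => ∑ k, (tetrahedron j k * √(s k)) • v k,
    fun j => Real.le_sqrt_of_sq_le ((norm_sum_tetrahedron b hs j).trans_le hsum),
    fun j => Real.le_sqrt_of_sq_le ((norm_sum_tetrahedron v hs j).trans_le hsum),
    hzero b, hzero v, ?_⟩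
  intro V _ _ B
  have hL : ∑ i, B (u i) (z i) = ∑ k, s k • B (b k) (v k) := by
    have h1 : ∀ i, B (u i) (z i) = ∑ k, inner ℝ (z i) (v k) • B (u i) (v k) := fun i => by
      conv_lhs => rw [← v.sum_repr' (z i)]
      rw [map_sum]
      refine Finset.sum_congr rfl fun k _ => ?_
      rw [map_smul, real_inner_comm]
    rw [Finset.sum_congr rfl fun i _ => h1 i, Finset.sum_comm]
    refine Finset.sum_congr rfl fun k _ => ?_
    rw [← LinearMap.smul_apply, ← map_smul, ← hsvd, hTv]
    simp
  rw [hL]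
  simp only [map_sum, map_smul, LinearMap.sum_apply, LinearMap.smul_apply, Finset.smul_sum,
    smul_smul]
  -- The coordinate columns of the tetrahedron are orthogonal, so the cross terms cancel.
  have h4 : ∀ k l, ∑ j, (1 / 4 * (tetrahedron j k * √(s k) * (tetrahedron j l * √(s l)))) •
      B (b l) (v k) = if k = l then s k • B (b k) (v k) else 0 := by
    intro k l
    rw [← Finset.sum_smul]
    have h5 : ∑ j, 1 / 4 * (tetrahedron j k * √(s k) * (tetrahedron j l * √(s l))) =
        1 / 4 * (√(s k) * √(s l)) * ∑ j, tetrahedron j k * tetrahedron j l := by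
      rw [Finset.mul_sum]
      exact Finset.sum_congr rfl fun j _ => by ring
    rw [h5, sum_tetrahedron_mul]
    split_ifs with h
    · subst h
      rw [Real.mul_self_sqrt (hs k)]
      congr 1
      ring
    · simp
  have h6 : ∀ k, ∑ j, ∑ l, (1 / 4 * (tetrahedron j k * √(s k) * (tetrahedron j l * √(s l)))) •
      B (b l) (v k) = s k • B (b k) (v k) := by
    intro k
    rw [Finset.sum_comm, Finset.sum_congr rfl fun l _ => h4 k l]
    simp
  exact (Finset.sum_congr rfl fun k _ => (h6 k).symm).trans Finset.sum_comm

/-- A sum of products of positive operators both of whose marginals are multiples of the identity is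
a sum of four products. -/
theorem fourTerm_of_marginals {ι : Type*} [Fintype ι] {x y : ι → ℝ} {u z : ι → Bloch}
    (hu : ∀ i, ‖u i‖ ≤ x i) (hz : ∀ i, ‖z i‖ ≤ y i) (hyu : ∑ i, y i • u i = 0)
    (hxz : ∑ i, x i • z i = 0) : FourTerm (∑ i, herm (x i) (u i) ⊗ₖ herm (y i) (z i)) := by
  obtain ⟨a, b, ha, hb, ha0, hb0, hB⟩ := exists_four_bloch_vectors hu hz
  set c := ∑ i, x i * y i with hc
  have hc0 : 0 ≤ c := Finset.sum_nonneg fun i _ =>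
    mul_nonneg ((norm_nonneg _).trans (hu i)) ((norm_nonneg _).trans (hz i))
  set K := kroneckerBilinear (l := Fin 2) (m := Fin 2) (n := Fin 2) (p := Fin 2) (α := ℂ) (R := ℝ)
  have hKa : ∀ A B : Mat2, A ⊗ₖ B = K A B := fun A B => rfl
  have expand : ∀ (t s : ℝ) (v w : Bloch), herm t v ⊗ₖ herm s w =
      (t * s) • K 1 1 + K (pauli (s • v)) 1 + K 1 (pauli (t • w)) + K (pauli v) (pauli w) := by
    intro t s v w
    rw [hKa, herm, herm]
    simp only [map_add, map_smul, LinearMap.add_apply, LinearMap.smul_apply]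
    module
  -- Scalar part `√c` on both sides dominates the vectors, and the four weights `1 / 4` restore the
  -- total `c`.
  refine ⟨fun j => (1 / 4 : ℝ) • herm √c (a j), fun j => herm √c (b j),
    fun j => (posSemidef_herm_iff.mpr (ha j)).smul (by norm_num),
    fun j => posSemidef_herm_iff.mpr (hb j), ?_⟩
  have hP := hB Mat22 ((K.compl₁₂ pauli pauli))
  simp only [LinearMap.compl₁₂_apply] at hP
  have e1 : ∑ i, K (pauli (y i • u i)) 1 = 0 := by
    rw [← LinearMap.sum_apply, ← map_sum, ← map_sum, hyu]; simp
  have e2 : ∑ i, K 1 (pauli (x i • z i)) = 0 := by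
    rw [← map_sum, ← map_sum, hxz]; simp
  have e3 : ∑ j, K (pauli (√c • a j)) 1 = 0 := by
    rw [← LinearMap.sum_apply, ← map_sum, ← map_sum, ← Finset.smul_sum, ha0]; simp
  have e4 : ∑ j, K 1 (pauli (√c • b j)) = 0 := by
    rw [← map_sum, ← map_sum, ← Finset.smul_sum, hb0]; simp
  simp only [smul_kronecker, expand, smul_add, Finset.sum_add_distrib, ← Finset.smul_sum,
    ← Finset.sum_smul, e1, e2, e3, e4, Real.mul_self_sqrt hc0] at hP ⊢
  rw [hP, ← hc]
  simp only [Finset.sum_const, Finset.card_univ, Fintype.card_fin, add_zero, smul_zero]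
  module

/-! ### Local filters that equalise the marginals -/

theorem herm_injective {t s : ℝ} {v w : Bloch} (h : herm t v = herm s w) : t = s ∧ v = w := by
  rw [herm_eq, herm_eq] at h
  have h00 := congrArg Complex.re (congrFun (congrFun h 0) 0)
  have h11 := congrArg Complex.re (congrFun (congrFun h 1) 1)
  have h10 := congrArg Complex.re (congrFun (congrFun h 1) 0)
  have h10i := congrArg Complex.im (congrFun (congrFun h 1) 0)
  simp at h00 h11 h10 h10i
  refine ⟨by linarith, ?_⟩
  ext k
  fin_cases k
  · exact h10
  · exact h10i
  · simp; linarith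

theorem sum_smul_herm {ι : Type*} [Fintype ι] (g x : ι → ℝ) (u : ι → Bloch) :
    ∑ i, g i • herm (x i) (u i) = herm (∑ i, g i * x i) (∑ i, g i • u i) := by
  simp only [herm, smul_add, Finset.sum_add_distrib, map_sum, map_smul, Finset.sum_smul, smul_smul]

theorem smul_herm (c t : ℝ) (v : Bloch) : c • herm t v = herm (c * t) (c • v) := by
  simp only [herm, smul_add, map_smul, smul_smul]

/-- First-order condition at a minimum of a linear functional on the unit hyperboloid. -/
theorem hyperboloid_minimum {r₀ : ℝ} {r v : Bloch} (hr : ‖r‖ < r₀)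
    (hmin : ∀ w : Bloch, r₀ * √(1 + ‖v‖ ^ 2) + inner ℝ v r ≤ r₀ * √(1 + ‖w‖ ^ 2) + inner ℝ w r) :
    √(1 + ‖v‖ ^ 2) • r = -r₀ • v := by
  have hr0 : 0 < r₀ := (norm_nonneg r).trans_lt hr
  have hm2 : 0 < r₀ ^ 2 - ‖r‖ ^ 2 := by nlinarith [norm_nonneg r]
  set m := √(r₀ ^ 2 - ‖r‖ ^ 2) with hm
  have hm0 : 0 < m := Real.sqrt_pos.mpr hm2
  have hmsq : m ^ 2 = r₀ ^ 2 - ‖r‖ ^ 2 := Real.sq_sqrt hm2.le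
  set t := √(1 + ‖v‖ ^ 2) with ht
  have ht0 : 0 < t := Real.sqrt_pos.mpr (by positivity)
  have htsq : t ^ 2 = 1 + ‖v‖ ^ 2 := Real.sq_sqrt (by positivity)
  have hle : r₀ * t + inner ℝ v r ≤ m := by
    -- This competitor attains the true minimum, the Minkowski length `m`.
    have h := hmin (-(m⁻¹ • r))
    have h1 : √(1 + ‖-(m⁻¹ • r)‖ ^ 2) = r₀ / m := by
      rw [norm_neg, norm_smul, Real.norm_of_nonneg (by positivity), Real.sqrt_eq_iff_mul_self_eq
        (by positivity) (by positivity)]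
      field_simp
      linarith
    rw [h1, inner_neg_left, inner_smul_left, real_inner_self_eq_norm_sq] at h
    refine h.trans_eq ?_
    simp
    field_simp
    linarith
  -- The bound `hle` makes this square at most `-(t * m - r₀) ^ 2`.
  have hsq : ‖t • r + r₀ • v‖ ^ 2 ≤ 0 := by
    rw [norm_add_sq_real, norm_smul, norm_smul, inner_smul_left, inner_smul_right,
      Real.norm_of_nonneg ht0.le, Real.norm_of_nonneg hr0.le, real_inner_comm]
    have h2 : 0 ≤ t * r₀ * (m - (r₀ * t + inner ℝ v r)) :=
      mul_nonneg (by positivity) (by linarith)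
    have h3 : ‖v‖ ^ 2 = t ^ 2 - 1 := by linarith
    have h4 : ‖r‖ ^ 2 = r₀ ^ 2 - m ^ 2 := by linarith
    simp only [conj_trivial]
    rw [mul_pow, mul_pow, h3, h4]
    nlinarith [sq_nonneg (t * m - r₀)]
  have h0 : t • r + r₀ • v = 0 := by
    have := sq_nonneg ‖t • r + r₀ • v‖
    exact norm_eq_zero.mp (pow_eq_zero_iff two_ne_zero |>.mp (le_antisymm hsq this))
  rw [neg_smul]
  exact eq_neg_of_add_eq_zero_left h0

/-- The local filter that turns a marginal proportional to the inverse of `herm t v` into a multiple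
of the identity. -/
theorem exists_local_filter {ι : Type*} [Fintype ι] {x : ι → ℝ} {u : ι → Bloch} {g : ι → ℝ}
    (hu : ∀ i, ‖u i‖ ≤ x i) {v : Bloch} {t : ℝ} (ht : t = √(1 + ‖v‖ ^ 2))
    (hg : t • ∑ i, g i • u i = -(∑ i, g i * x i) • v) :
    ∃ S : Mat2, IsUnit S ∧ ∃ u' : ι → Bloch, (∀ i, ‖u' i‖ ≤ x i * t + inner ℝ v (u i)) ∧
      (∀ i, S * herm (x i) (u i) * Sᴴ = herm (x i * t + inner ℝ v (u i)) (u' i)) ∧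
      ∑ i, g i • u' i = 0 := by
  have ht0 : 0 < t := ht ▸ Real.sqrt_pos.mpr (by positivity)
  have htsq : t ^ 2 - ‖v‖ ^ 2 = 1 := by rw [ht, Real.sq_sqrt (by positivity)]; ring
  have hP : (herm t v).PosSemidef :=
    posSemidef_herm_iff.mpr (abs_le_of_sq_le_sq' (by linarith) ht0.le).2
  obtain ⟨S, hS⟩ : ∃ S : Mat2, herm t v = Sᴴ * S := by
    open scoped MatrixOrder in
    exact CStarAlgebra.nonneg_iff_eq_star_mul_self.mp hP.nonneg
  -- Congruence by `S` sends `herm t (-v)`, the inverse of `Sᴴ * S`, to the identity, and `hg` makes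
  -- the marginal a multiple of that inverse.
  have h1 : Sᴴ * (S * herm t (-v)) = 1 := by
    rw [← mul_assoc, ← hS, herm_mul_herm_neg htsq]
  have h2 : S * herm t (-v) * Sᴴ = 1 := mul_eq_one_comm.mp h1
  have hSu : IsUnit S := by
    rw [mul_assoc] at h2
    exact IsUnit.of_mul_eq_one _ h2
  have h3 : ∀ i, ∃ u', S * herm (x i) (u i) * Sᴴ = herm (x i * t + inner ℝ v (u i)) u' ∧
      ‖u'‖ ≤ x i * t + inner ℝ v (u i) := by
    intro i
    obtain ⟨s, w, hsw, hw⟩ := exists_herm_of_posSemidef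
      ((posSemidef_herm_iff.mpr (hu i)).mul_mul_conjTranspose_same S)
    have h4 : (herm s w).trace = (herm t v * herm (x i) (u i)).trace := by
      rw [← hsw, hS, trace_mul_comm, mul_assoc]
    rw [trace_herm, trace_herm_mul_herm] at h4
    have h5 : 2 * s = 2 * (t * x i + inner ℝ v (u i)) := by exact_mod_cast h4
    have h6 : s = x i * t + inner ℝ v (u i) := by linarith
    exact ⟨w, by rw [hsw, h6], h6 ▸ hw⟩
  choose u' hu' hn using h3
  refine ⟨S, hSu, u', hn, hu', ?_⟩
  set r₀ := ∑ i, g i * x i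
  have h7 : ∑ i, g i • herm (x i) (u i) = (r₀ / t) • herm t (-v) := by
    rw [sum_smul_herm, smul_herm]
    congr 1
    · rw [div_mul_cancel₀ _ ht0.ne']
    · rw [← smul_right_inj ht0.ne', hg, smul_smul]
      field_simp
      simp
  have h8 : ∑ i, g i • herm (x i * t + inner ℝ v (u i)) (u' i) = herm (r₀ / t) 0 := by
    calc _ = S * (∑ i, g i • herm (x i) (u i)) * Sᴴ := by
          simp only [Finset.mul_sum, Finset.sum_mul, mul_smul_comm, smul_mul_assoc, hu']
      _ = _ := by
          rw [h7, mul_smul_comm, smul_mul_assoc, h2]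
          simp [herm]
  rw [sum_smul_herm] at h8
  exact (herm_injective h8).2

/-- The function `f` is a quarter of the trace after filtering. The term `o`, a positive multiple of
the identity, makes `f` coercive and keeps the marginals in the interior of the positive cone.
Stationarity in each variable at a minimum is the hypothesis of `exists_local_filter`. -/
theorem fourTerm_of_strict {ι : Type} [Fintype ι] {x y : ι → ℝ} {u z : ι → Bloch}
    (hu : ∀ i, ‖u i‖ ≤ x i) (hz : ∀ i, ‖z i‖ ≤ y i) {o : ι} (hou : u o = 0) (hoz : z o = 0)
    (hox : 0 < x o) (hoy : 0 < y o) : FourTerm (∑ i, herm (x i) (u i) ⊗ₖ herm (y i) (z i)) := by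
  have hcosh : ∀ v : Bloch, ‖v‖ < √(1 + ‖v‖ ^ 2) := fun v =>
    Real.lt_sqrt_of_sq_lt (by linarith)
  have hnn : ∀ {a : ℝ} {b v : Bloch}, ‖b‖ ≤ a → 0 ≤ a * √(1 + ‖v‖ ^ 2) + inner ℝ v b := by
    intro a b v hb
    have h1 := abs_le.mp (abs_real_inner_le_norm v b)
    have h2 : ‖v‖ * ‖b‖ ≤ √(1 + ‖v‖ ^ 2) * a :=
      mul_le_mul (hcosh v).le hb (norm_nonneg _) (Real.sqrt_nonneg _)
    linarith [h1.1]
  have hone : ∀ v : Bloch, 1 ≤ √(1 + ‖v‖ ^ 2) := fun v =>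
    Real.one_le_sqrt.mpr (by linarith [sq_nonneg ‖v‖])
  set f : Bloch × Bloch → ℝ := fun q => ∑ i,
    (x i * √(1 + ‖q.1‖ ^ 2) + inner ℝ q.1 (u i)) * (y i * √(1 + ‖q.2‖ ^ 2) + inner ℝ q.2 (z i))
    with hf
  have hfc : Continuous f := by fun_prop
  have hlow : ∀ q, x o * y o * ‖q‖ ≤ f q := by
    intro q
    have h1 : (x o * √(1 + ‖q.1‖ ^ 2)) * (y o * √(1 + ‖q.2‖ ^ 2)) ≤ f q := by
      have := Finset.single_le_sum (f := fun i => (x i * √(1 + ‖q.1‖ ^ 2) + inner ℝ q.1 (u i)) *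
        (y i * √(1 + ‖q.2‖ ^ 2) + inner ℝ q.2 (z i)))
        (fun i _ => mul_nonneg (hnn (hu i)) (hnn (hz i))) (Finset.mem_univ o)
      simpa [hou, hoz] using this
    refine le_trans ?_ h1
    have h2 : ‖q‖ ≤ √(1 + ‖q.1‖ ^ 2) * √(1 + ‖q.2‖ ^ 2) := by
      refine max_le ?_ ?_
      · exact (hcosh _).le.trans (le_mul_of_one_le_right (Real.sqrt_nonneg _) (hone _))
      · exact (hcosh _).le.trans (le_mul_of_one_le_left (Real.sqrt_nonneg _) (hone _))
    calc x o * y o * ‖q‖ ≤ x o * y o * (√(1 + ‖q.1‖ ^ 2) * √(1 + ‖q.2‖ ^ 2)) := by gcongr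
      _ = _ := by ring
  obtain ⟨⟨v, w⟩, hmin⟩ : ∃ q, ∀ q', f q ≤ f q' := by
    refine hfc.exists_forall_le ?_
    refine Filter.tendsto_atTop_mono hlow ?_
    exact (tendsto_norm_cocompact_atTop).const_mul_atTop (mul_pos hox hoy)
  have hstrict : ∀ {a g : ι → ℝ} {b : ι → Bloch}, (∀ i, ‖b i‖ ≤ a i) → (∀ i, 0 ≤ g i) →
      b o = 0 → 0 < a o → 0 < g o → ‖∑ i, g i • b i‖ < ∑ i, g i * a i := by
    intro a g b hab hg hb ha hgo
    refine (norm_sum_le _ _).trans_lt (Finset.sum_lt_sum (fun i _ => ?_) ⟨o, Finset.mem_univ o, ?_⟩)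
    · rw [norm_smul, Real.norm_of_nonneg (hg i)]
      exact mul_le_mul_of_nonneg_left (hab i) (hg i)
    · simp [hb]
      positivity
  set g : ι → ℝ := fun i => y i * √(1 + ‖w‖ ^ 2) + inner ℝ w (z i) with hgdef
  set h : ι → ℝ := fun i => x i * √(1 + ‖v‖ ^ 2) + inner ℝ v (u i) with hhdef
  have hfv : ∀ v', f (v', w) = (∑ i, g i * x i) * √(1 + ‖v'‖ ^ 2) + inner ℝ v' (∑ i, g i • u i) := by
    intro v'
    rw [inner_sum, Finset.sum_mul, ← Finset.sum_add_distrib]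
    refine Finset.sum_congr rfl fun i _ => ?_
    rw [inner_smul_right]
    simp only [hgdef]
    ring
  have hfw : ∀ w', f (v, w') = (∑ i, h i * y i) * √(1 + ‖w'‖ ^ 2) + inner ℝ w' (∑ i, h i • z i) := by
    intro v'
    rw [inner_sum, Finset.sum_mul, ← Finset.sum_add_distrib]
    refine Finset.sum_congr rfl fun i _ => ?_
    rw [inner_smul_right]
    simp only [hhdef]
    ring
  have hgo : 0 < g o := by
    simp only [hgdef, hoz, inner_zero_right, add_zero]
    exact mul_pos hoy (zero_lt_one.trans_le (hone w))
  have hho : 0 < h o := by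
    simp only [hhdef, hou, inner_zero_right, add_zero]
    exact mul_pos hox (zero_lt_one.trans_le (hone v))
  have hv := hyperboloid_minimum (hstrict hu (fun i => hnn (hz i)) hou hox hgo)
    (fun v' => by rw [← hfv, ← hfv]; exact hmin (v', w))
  have hw := hyperboloid_minimum (hstrict hz (fun i => hnn (hu i)) hoz hoy hho)
    (fun w' => by rw [← hfw, ← hfw]; exact hmin (v, w'))
  obtain ⟨S, hS, u', hu', hSu, hsu⟩ := exists_local_filter hu rfl hv
  obtain ⟨T, hT, z', hz', hTz, hsz⟩ := exists_local_filter hz rfl hw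
  refine FourTerm.of_conj hS hT ?_
  have key := fourTerm_of_marginals hu' hz' hsu hsz
  convert key using 1
  simp only [Finset.mul_sum, Finset.sum_mul, conjTranspose_kronecker, ← mul_kronecker_mul,
    hSu, hTz]

/-- A finite sum of products of positive operators of two qubits is a sum of four such products. -/
theorem fourTerm_sum {ι : Type} [Fintype ι] {ω β : ι → Mat2} (hω : ∀ i, (ω i).PosSemidef)
    (hβ : ∀ i, (β i).PosSemidef) : FourTerm (∑ i, ω i ⊗ₖ β i) := by
  choose x u hx hu using fun i => exists_herm_of_posSemidef (hω i)
  choose y z hy hz using fun i => exists_herm_of_posSemidef (hβ i)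
  refine fourTerm_of_forall_add_smul_one fun ε hε => ?_
  have key := fourTerm_of_strict (ι := Option ι) (x := fun i => i.elim ε x)
    (u := fun i => i.elim 0 u) (y := fun i => i.elim 1 y) (z := fun i => i.elim 0 z) (o := none)
    (by rintro (_ | i) <;> simp [hε.le, hu]) (by rintro (_ | i) <;> simp [hz]) rfl rfl hε
    zero_lt_one
  convert key using 1
  rw [Fintype.sum_option, add_comm]
  congr 1
  · simp [herm, smul_kronecker]
  · exact Finset.sum_congr rfl fun i _ => by rw [hx i, hy i]; rfl

/-! ### From four products to shared randomness -/

theorem FourTerm.exists_convex_combination {ρ : Mat22} (h : FourTerm ρ) (hρ : ρ.trace = 1) :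
    ∃ (p : Fin 4 → ℝ) (α β : Fin 4 → Mat2), (∀ i, 0 ≤ p i) ∧ ∑ i, p i = 1 ∧
      (∀ i, Steering.IsState (α i)) ∧ (∀ i, Steering.IsState (β i)) ∧
      ρ = ∑ i, p i • (α i ⊗ₖ β i) := by
  obtain ⟨p, a, b, hp, ha, hb, rfl⟩ := h.exists_weights
  refine ⟨fun i => 4 * p i, fun i => (1 / 2 : ℝ) • herm 1 (a i), fun i => (1 / 2 : ℝ) • herm 1 (b i),
    fun i => mul_nonneg (by norm_num) (hp i), ?_, fun i => isState_half_herm (ha i),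
    fun i => isState_half_herm (hb i), ?_⟩
  · rw [trace_sum_weights] at hρ
    rw [← Finset.mul_sum]
    exact_mod_cast hρ
  · refine Finset.sum_congr rfl fun i _ => ?_
    rw [smul_kronecker, kronecker_smul, smul_smul, smul_smul]
    congr 1
    ring

theorem FourTerm.isSeparable {ρ : Mat22} (h : FourTerm ρ) (hρ : ρ.trace = 1) :
    Steering.IsSeparable ρ := by
  obtain ⟨p, α, β, h⟩ := h.exists_convex_combination hρ
  exact ⟨4, p, α, β, h⟩

theorem fourTerm_of_isSeparable {ρ : Mat22} (h : Steering.IsSeparable ρ) : FourTerm ρ := by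
  obtain ⟨m, p, α, β, hp, -, hα, hβ, rfl⟩ := h
  have key := fourTerm_sum (fun i => (hα i).posSemidef.smul (hp i)) fun i => (hβ i).posSemidef
  simpa only [smul_kronecker] using key

/-- The operator on the second qubit obtained by fixing the indices of the first one. -/
def block (ρ : Mat22) (a a' : Fin 2) : Mat2 := Matrix.of fun b b' => ρ (a, b) (a', b')

theorem steered_eq_sum_block (ρ : Mat22) (M : Mat2) :
    Steering.steered ρ M = ∑ a, ∑ a', M a a' • block ρ a' a := by
  ext b b'
  simp [Steering.steered, Steering.partialTraceA, block, Matrix.mul_apply, Fintype.sum_prod_type,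
    Fin.sum_univ_two, Matrix.one_apply, Matrix.add_apply]

theorem steered_smul_kronecker (p : ℝ) (α β M : Mat2) :
    Steering.steered (p • (α ⊗ₖ β)) M = p • (M * α).trace • β := by
  rw [steered_eq_sum_block]
  ext b b'
  simp [block, Fin.sum_univ_two, Matrix.trace, Matrix.mul_apply]
  ring

theorem steered_sum {ι : Type*} [Fintype ι] (ρ : ι → Mat22) (M : Mat2) :
    Steering.steered (∑ i, ρ i) M = ∑ i, Steering.steered (ρ i) M := by
  simp only [steered_eq_sum_block]
  ext b b'
  simp [block, Fin.sum_univ_two, Matrix.sum_apply, Finset.mul_sum, Finset.sum_add_distrib]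
  ring

theorem trace_mul_of_posSemidef {M N : Mat2} (hM : M.PosSemidef) (hN : N.PosSemidef) :
    0 ≤ (M * N).trace.re ∧ (M * N).trace = ((M * N).trace.re : ℂ) := by
  obtain ⟨t, v, rfl, hv⟩ := exists_herm_of_posSemidef hM
  obtain ⟨s, w, rfl, hw⟩ := exists_herm_of_posSemidef hN
  rw [trace_herm_mul_herm, ofReal_re]
  refine ⟨?_, rfl⟩
  have h1 := abs_le.mp (abs_real_inner_le_norm v w)
  have h2 : ‖v‖ * ‖w‖ ≤ t * s := mul_le_mul hv hw (norm_nonneg _) ((norm_nonneg _).trans hv)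
  linarith [h1.1]

/-- A mixture of `n` product states with positive weights is simulable with shared randomness of
size `n`. -/
theorem simulable_of_mixture {n : ℕ} {p : Fin n → ℝ} {α β : Fin n → Mat2} (hp : ∀ i, 0 < p i)
    (hp1 : ∑ i, p i = 1) (hα : ∀ i, Steering.IsState (α i)) (hβ : ∀ i, Steering.IsState (β i)) :
    Steering.Simulable (∑ i, p i • (α i ⊗ₖ β i)) n := by
  rintro X k σ ⟨M, hM, hσ⟩
  refine ⟨p, β, fun x i a => (M x a * α i).trace.re, hp, hp1, hβ,
    fun x i a => (trace_mul_of_posSemidef ((hM x).posSemidef a) (hα i).posSemidef).1,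
    fun x i => ?_, fun x a => ?_⟩
  · rw [← re_sum, ← trace_sum, ← Finset.sum_mul, (hM x).sum_eq_one, one_mul,
      (hα i).trace_eq_one, one_re]
  · rw [hσ, steered_sum]
    refine Finset.sum_congr rfl fun i _ => ?_
    rw [steered_smul_kronecker,
      (trace_mul_of_posSemidef ((hM x).posSemidef a) (hα i).posSemidef).2]
    change _ = (_ * p i) • β i
    rw [mul_comm, mul_smul]
    rfl

/-- Shared randomness must have positive weights, so the vanishing terms are dropped; hence `n ≤ 4`
rather than `n = 4`. -/
theorem FourTerm.exists_simulable {ρ : Mat22} (h : FourTerm ρ) (hρ : ρ.trace = 1) :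
    ∃ n ≤ 4, Steering.Simulable ρ n := by
  obtain ⟨p, α, β, hp, hp1, hα, hβ, rfl⟩ := h.exists_convex_combination hρ
  set e := Fintype.equivFin {i // 0 < p i}
  have hsum : ∀ {V : Type} [AddCommGroup V] [Module ℝ V] (f : Fin 4 → V),
      ∑ j, p (e.symm j).1 • f (e.symm j).1 = ∑ i, p i • f i := by
    intro V _ _ f
    rw [e.symm.sum_comp fun i => p i.1 • f i.1,
      ← Finset.sum_subtype (Finset.univ.filter fun i => 0 < p i) (by simp) fun i => p i • f i]
    refine Finset.sum_filter_of_ne fun i _ hi => (hp i).lt_of_ne' fun h0 => hi ?_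
    rw [h0, zero_smul]
  refine ⟨Fintype.card {i // 0 < p i}, ?_, ?_⟩
  rotate_left
  · have key := simulable_of_mixture (p := fun j => p (e.symm j).1) (α := fun j => α (e.symm j).1)
      (β := fun j => β (e.symm j).1) (fun j => (e.symm j).2) ?_ (fun j => hα _) fun j => hβ _
    · rwa [hsum fun i => α i ⊗ₖ β i] at key
    · simpa [hp1] using hsum fun _ => (1 : ℝ)
  · simpa using Fintype.card_subtype_le fun i => 0 < p i

/-! ### States whose blocks satisfy a linear relation -/

theorem block_conj (ρ : Mat22) (T : Mat2) (a a' : Fin 2) :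
    block (((1 : Mat2) ⊗ₖ T) * ρ * ((1 : Mat2) ⊗ₖ T)ᴴ) a a' = T * block ρ a a' * Tᴴ := by
  ext b b'
  simp [block, Matrix.mul_apply, Fintype.sum_prod_type, Fin.sum_univ_two, Matrix.one_apply]
  fin_cases a <;> fin_cases a' <;> simp

theorem conjTranspose_block {ρ : Mat22} (h : ρ.IsHermitian) (a a' : Fin 2) :
    (block ρ a a')ᴴ = block ρ a' a := by
  ext b b'
  simpa [block] using h.apply (a', b) (a, b')

/-- Two-by-two Hermitian matrices, one of them positive definite, are simultaneously
diagonalisable by a congruence. -/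
theorem exists_congruence_diagonal {A B : Mat2} (hA : A.PosDef) (hB : B.IsHermitian) :
    ∃ (W : Mat2) (x : Fin 2 → ℝ), IsUnit W ∧ A = Wᴴ * W ∧
      B = Wᴴ * diagonal (fun k => (x k : ℂ)) * W := by
  obtain ⟨S, hS⟩ : ∃ S : Mat2, A = Sᴴ * S := by
    open scoped MatrixOrder in
    exact CStarAlgebra.nonneg_iff_eq_star_mul_self.mp hA.posSemidef.nonneg
  have hSu : IsUnit S := by
    have h := hA.isUnit
    rw [hS] at h
    exact isUnit_of_mul_isUnit_right h
  obtain ⟨S, rfl⟩ := hSu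
  set R : Mat2 := (↑S⁻¹ : Mat2)
  have hRS : R * (S : Mat2) = 1 := by simp [R]
  have hRS' : (S : Mat2)ᴴ * Rᴴ = 1 := by rw [← conjTranspose_mul, hRS, conjTranspose_one]
  have hX : (Rᴴ * B * R).IsHermitian := isHermitian_conjTranspose_mul_mul R hB
  set U : Mat2 := (hX.eigenvectorUnitary : Mat2)
  have hUU : U * Uᴴ = 1 := Unitary.coe_mul_star_self hX.eigenvectorUnitary
  have hspec : Rᴴ * B * R = U * diagonal (fun k => (hX.eigenvalues k : ℂ)) * Uᴴ :=
    hX.spectral_theorem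
  refine ⟨Uᴴ * S, hX.eigenvalues, ?_, ?_, ?_⟩
  · exact (IsUnit.of_mul_eq_one _ (mul_eq_one_comm.mp hUU)).mul S.isUnit
  · rw [hS, conjTranspose_mul, conjTranspose_conjTranspose, mul_assoc, ← mul_assoc U, hUU, one_mul]
  · rw [conjTranspose_mul, conjTranspose_conjTranspose]
    calc B = (S : Mat2)ᴴ * (Rᴴ * B * R) * S := by
          rw [mul_assoc, mul_assoc (Rᴴ * B), hRS, mul_one, ← mul_assoc, hRS', one_mul]
      _ = (S : Mat2)ᴴ * (U * diagonal (fun k => (hX.eigenvalues k : ℂ)) * Uᴴ) * (S : Mat2) :=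
          congrArg (fun M => (S : Mat2)ᴴ * M * S) hspec
      _ = _ := by simp only [mul_assoc]

/-- A positive operator invariant under the partial transposition of the second qubit is a sum of
product operators. -/
theorem fourTerm_of_partialTranspose_eq {ρ : Mat22} (hρ : ρ.PosSemidef)
    (hsym : ∀ a a', ρ (a, 0) (a', 1) = ρ (a, 1) (a', 0)) : FourTerm ρ := by
  refine fourTerm_of_forall_add_smul_one fun ε hε => ?_
  set η : Mat22 := ρ + ε • 1 with hη
  have hηd : η.PosDef := by
    rw [hη, add_comm]
    exact (PosDef.one.smul hε).add_posSemidef hρ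
  have hηsym : ∀ a a', η (a, 0) (a', 1) = η (a, 1) (a', 0) := fun a a' => by simp [hη, hsym]
  clear_value η
  set A : Mat2 := Matrix.of fun a a' => η (a, 0) (a', 0) with hAdef
  set B : Mat2 := Matrix.of fun a a' => η (a, 0) (a', 1) with hBdef
  set C : Mat2 := Matrix.of fun a a' => η (a, 1) (a', 1) with hCdef
  have hA : A.PosDef := hηd.submatrix (e := fun a : Fin 2 => (a, (0 : Fin 2)))
    fun a a' h => congrArg Prod.fst h
  have hB : B.IsHermitian := by
    ext a a'
    simpa [hBdef, hηsym a a'] using hηd.isHermitian.apply (a, 1) (a', 0)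
  have hblocks : (fromBlocks A B Bᴴ C).PosSemidef := by
    have h := hηd.posSemidef.submatrix
      (Sum.elim (fun a : Fin 2 => (a, (0 : Fin 2))) fun a => (a, 1))
    convert h using 1
    rw [hB.eq]
    ext (a | a) (a' | a') <;> simp [hAdef, hBdef, hCdef, hηsym]
  let := hA.isUnit.invertible
  have hschur := (PosDef.fromBlocks₁₁ B C hA).mp hblocks
  rw [hB.eq] at hschur
  obtain ⟨W, x, hW, hAW, hBW⟩ := exists_congruence_diagonal hA hB
  set D : Mat2 := diagonal fun k => (x k : ℂ)
  have hBAB : B * A⁻¹ * B = Wᴴ * (D * D) * W := by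
    have hW' : IsUnit Wᴴ := hW.star
    have hdet := (isUnit_iff_isUnit_det W).mp hW
    have hdet' := (isUnit_iff_isUnit_det Wᴴ).mp hW'
    rw [hAW, hBW, Matrix.mul_inv_rev]
    calc Wᴴ * D * W * (W⁻¹ * Wᴴ⁻¹) * (Wᴴ * D * W)
        = Wᴴ * D * (W * W⁻¹) * (Wᴴ⁻¹ * Wᴴ) * D * W := by simp only [mul_assoc]
      _ = _ := by
        rw [mul_nonsing_inv _ hdet, nonsing_inv_mul _ hdet']
        simp only [mul_one, mul_assoc]
  -- From `A = Wᴴ * W` and `B = Wᴴ * D * W`, the rows of `W` paired with the vectors `(1, x k)`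
  -- reproduce `A`, `B` and the corner `B * A⁻¹ * B`. The Schur complement is what remains of `C`.
  have key := fourTerm_sum (ι := Option (Fin 2))
    (ω := fun i => i.elim (C - B * A⁻¹ * B) fun k => vecMulVec (star (W k)) (W k))
    (β := fun i => i.elim (vecMulVec ![0, 1] (star ![0, 1])) fun k =>
      vecMulVec ![1, (x k : ℂ)] (star ![1, (x k : ℂ)]))
    (by
      rintro (_ | k)
      · exact hschur
      · exact posSemidef_vecMulVec_star_self _)
    (by
      rintro (_ | k)
      · exact posSemidef_vecMulVec_self_star _
      · exact posSemidef_vecMulVec_self_star _)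
  convert key using 1
  have eA : ∀ a a', η (a, 0) (a', 0) = ∑ k, star (W k a) * W k a' := fun a a' => by
    simpa [hAdef, Matrix.mul_apply] using congrFun (congrFun hAW a) a'
  have eB : ∀ a a', η (a, 0) (a', 1) = ∑ k, star (W k a) * x k * W k a' := fun a a' => by
    simpa [hBdef, Matrix.mul_apply, D] using congrFun (congrFun hBW a) a'
  have eBAB : ∀ a a', (B * A⁻¹ * B) a a' = ∑ k, star (W k a) * (x k * x k) * W k a' :=
    fun a a' => by
      simpa [Matrix.mul_apply, D, diagonal_mul_diagonal] using congrFun (congrFun hBAB a) a'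
  rw [Fintype.sum_option]
  dsimp only [Option.elim_none, Option.elim_some]
  ext ⟨a, b⟩ ⟨a', b'⟩
  simp only [Matrix.add_apply, Matrix.sum_apply, Matrix.sub_apply, kroneckerMap_apply,
    vecMulVec_apply]
  fin_cases b <;> fin_cases b'
  · simp [eA, Fin.sum_univ_two]
  · simp [eB, Fin.sum_univ_two]
    ring
  · simp [← hηsym, eB, Fin.sum_univ_two]
    ring
  · simp [eBAB, hCdef, Fin.sum_univ_two]
    ring

/-- A positive operator supported on `ℂ² ⊗ |j⟩` is a product operator. -/
theorem fourTerm_of_diag_eq_zero {ρ : Mat22} (hρ : ρ.PosSemidef) {j k : Fin 2} (hjk : j ≠ k)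
    (hk : ∀ a, ρ (a, k) (a, k) = 0) : FourTerm ρ := by
  obtain ⟨S, hS⟩ : ∃ S : Mat22, ρ = Sᴴ * S := by
    open scoped MatrixOrder in
    exact CStarAlgebra.nonneg_iff_eq_star_mul_self.mp hρ.nonneg
  have hcol : ∀ a i, S i (a, k) = 0 := by
    intro a i
    have h := hk a
    rw [hS, Matrix.mul_apply] at h
    simp only [conjTranspose_apply] at h
    have h' := (Finset.sum_eq_zero_iff_of_nonneg fun i _ => star_mul_self_nonneg (S i (a, k))).mp h
      i (Finset.mem_univ i)
    simpa using h'
  have hz1 : ∀ a q, ρ (a, k) q = 0 := fun a q => by simp [hS, Matrix.mul_apply, hcol]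
  have hz2 : ∀ a q, ρ q (a, k) = 0 := fun a q => by simp [hS, Matrix.mul_apply, hcol]
  have key := fourTerm_sum (ι := Unit) (ω := fun _ => ρ.submatrix (fun a => (a, j)) fun a => (a, j))
    (β := fun _ => vecMulVec (Pi.single j 1) (star (Pi.single j 1)))
    (fun _ => hρ.submatrix _) fun _ => posSemidef_vecMulVec_self_star _
  convert key using 1
  ext ⟨a, b⟩ ⟨a', b'⟩
  have hcase : ∀ b : Fin 2, b = j ∨ b = k := by
    intro b
    fin_cases b <;> fin_cases j <;> fin_cases k <;> simp_all
  rcases hcase b with rfl | rfl <;> rcases hcase b' with rfl | rfl <;>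
    simp [vecMulVec_apply, hz1, hz2, hjk.symm]

theorem fourTerm_of_unit_conj {ρ : Mat22} {T : Mat2} (hT : IsUnit T)
    (h : FourTerm (((1 : Mat2) ⊗ₖ T) * ρ * ((1 : Mat2) ⊗ₖ T)ᴴ)) : FourTerm ρ :=
  h.of_conj isUnit_one hT

theorem trace_mul_block_conj (ρ : Mat22) (H T : Mat2) (a a' : Fin 2) :
    (H * block (((1 : Mat2) ⊗ₖ T) * ρ * ((1 : Mat2) ⊗ₖ T)ᴴ) a a').trace =
      (Tᴴ * H * T * block ρ a a').trace := by
  rw [block_conj, ← mul_assoc, trace_mul_comm]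
  simp only [mul_assoc]

/-- A positive operator all of whose blocks are orthogonal to a nonzero diagonal matrix with
diagonal entries of the same sign is a product operator. -/
theorem fourTerm_of_trace_diagonal {ρ : Mat22} (hρ : ρ.PosSemidef) {l : Fin 2 → ℝ} {j k : Fin 2}
    (hjk : j ≠ k) (hk : l k ≠ 0) (hl : 0 ≤ l j * l k)
    (h : ∀ a a', (diagonal (fun i => (l i : ℂ)) * block ρ a a').trace = 0) : FourTerm ρ := by
  refine fourTerm_of_diag_eq_zero hρ hjk fun a => ?_
  have h1 := h a a
  have h2 : (l j : ℂ) * ρ (a, j) (a, j) + l k * ρ (a, k) (a, k) = 0 := by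
    rw [← h1]
    fin_cases j <;> fin_cases k <;>
      simp_all [Matrix.trace, block, Fin.sum_univ_two, add_comm]
  have hnn : ∀ q, 0 ≤ (ρ q q).re ∧ (ρ q q).im = 0 := fun q => by
    have := Complex.le_def.mp (hρ.diag_nonneg (i := q))
    exact ⟨this.1, this.2.symm⟩
  have h3 := congrArg Complex.re h2
  simp at h3
  have h4 : l k ^ 2 * (ρ (a, k) (a, k)).re = -(l j * l k * (ρ (a, j) (a, j)).re) := by
    linear_combination l k * h3
  have h5 := mul_nonneg hl (hnn (a, j)).1
  have h6 : (ρ (a, k) (a, k)).re = 0 := by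
    have hk2 : 0 < l k ^ 2 := by positivity
    by_contra hne
    have := mul_pos hk2 ((hnn (a, k)).1.lt_of_ne' hne)
    linarith
  exact Complex.ext h6 (hnn (a, k)).2

/-- A positive operator all of whose blocks are orthogonal to a nonzero Hermitian matrix is a sum of
four products. -/
theorem fourTerm_of_trace_block_eq_zero {ρ : Mat22} (hρ : ρ.PosSemidef) {H : Mat2}
    (hH : H.IsHermitian) (hH0 : H ≠ 0) (h : ∀ a a', (H * block ρ a a').trace = 0) :
    FourTerm ρ := by
  set U : Mat2 := (hH.eigenvectorUnitary : Mat2)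
  set l := hH.eigenvalues
  have hspec : H = U * diagonal (fun k => (l k : ℂ)) * Uᴴ := hH.spectral_theorem
  have hUU : U * Uᴴ = 1 := Unitary.coe_mul_star_self hH.eigenvectorUnitary
  have hUunit : IsUnit Uᴴ := IsUnit.of_mul_eq_one _ (mul_eq_one_comm.mp hUU)
  have h' : ∀ a a', (diagonal (fun k => (l k : ℂ)) *
      block (((1 : Mat2) ⊗ₖ Uᴴ) * ρ * ((1 : Mat2) ⊗ₖ Uᴴ)ᴴ) a a').trace = 0 := fun a a' => by
    rw [trace_mul_block_conj, conjTranspose_conjTranspose, ← hspec, h]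
  refine fourTerm_of_unit_conj hUunit ?_
  have hpos := hρ.mul_mul_conjTranspose_same ((1 : Mat2) ⊗ₖ Uᴴ)
  generalize ((1 : Mat2) ⊗ₖ Uᴴ) * ρ * ((1 : Mat2) ⊗ₖ Uᴴ)ᴴ = η at h' hpos
  rcases le_or_gt 0 (l 0 * l 1) with hl | hl
  · by_cases h1 : l 1 = 0
    · have h0 : l 0 ≠ 0 := by
        intro h0
        refine hH0 ?_
        have : (fun k => (l k : ℂ)) = 0 := by
          ext k
          fin_cases k <;> simp [h0, h1]
        rw [hspec, this]
        simp
      exact fourTerm_of_trace_diagonal hpos (j := 1) (k := 0) (by decide) h0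
        (by rwa [mul_comm]) h'
    · exact fourTerm_of_trace_diagonal hpos (j := 0) (k := 1) (by decide) h1 hl h'
  · have hl0 : l 0 ≠ 0 := fun h0 => by simp [h0] at hl
    have hl1 : l 1 ≠ 0 := fun h1 => by simp [h1] at hl
    set s : ℂ := ((√|l 0| : ℝ) : ℂ) with hs
    set t : ℂ := ((√|l 1| : ℝ) : ℂ) with ht
    have hs0 : s ≠ 0 := by simp [hs, hl0]
    have ht0 : t ≠ 0 := by simp [ht, hl1]
    have hs2 : s * s = ((|l 0| : ℝ) : ℂ) := by
      rw [hs, ← ofReal_mul, Real.mul_self_sqrt (abs_nonneg _)]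
    have ht2 : t * t = ((|l 1| : ℝ) : ℂ) := by
      rw [ht, ← ofReal_mul, Real.mul_self_sqrt (abs_nonneg _)]
    -- Chosen so that `Tᴴ * σ_y * T` is proportional to `diag(s², -t²)`, itself proportional to
    -- `diag(l 0, l 1)`. Orthogonality to `H` becomes orthogonality to `σ_y`, that is, symmetry of
    -- every block.
    set T : Mat2 := !![s, t; I * s, -(I * t)] with hT
    have hTu : IsUnit T := by
      rw [isUnit_iff_isUnit_det, hT, det_fin_two_of, isUnit_iff_ne_zero]
      have : s * -(I * t) - t * (I * s) = -2 * I * s * t := by ring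
      rw [this]
      simp [hs0, ht0]
    have hblock : ∀ a a', (l 0 : ℂ) * η (a, 0) (a', 0) + l 1 * η (a, 1) (a', 1) = 0 := by
      intro a a'
      have := h' a a'
      simpa [Matrix.trace, block, Fin.sum_univ_two] using this
    have hst : ∀ a a', s * s * η (a, 0) (a', 0) - t * t * η (a, 1) (a', 1) = 0 := by
      intro a a'
      rw [hs2, ht2]
      rcases lt_or_gt_of_ne hl0 with h0 | h0
      · have h1 : 0 < l 1 := by nlinarith
        rw [abs_of_neg h0, abs_of_pos h1]
        push_cast
        linear_combination -hblock a a'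
      · have h1 : l 1 < 0 := by nlinarith
        rw [abs_of_pos h0, abs_of_neg h1]
        push_cast
        linear_combination hblock a a'
    refine fourTerm_of_unit_conj hTu (fourTerm_of_partialTranspose_eq
      (hpos.mul_mul_conjTranspose_same _) fun a a' => ?_)
    have hb := fun b b' => congrFun (congrFun (block_conj η T a a') b) b'
    have hss : star s = s := conj_ofReal _
    have htt : star t = t := conj_ofReal _
    have h01 := hb 0 1
    have h10 := hb 1 0
    simp only [block, of_apply] at h01 h10
    rw [h01, h10]
    simp only [hT, Matrix.mul_apply, Fin.sum_univ_two, conjTranspose_apply, of_apply, cons_val_zero,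
      cons_val_one, cons_val', star_mul', star_neg, hss, htt]
    simp
    linear_combination (-2 * I) * hst a a'

/-! ### From four hidden states to four products -/

/-- Positive semidefinite matrices span all matrices. -/
theorem mem_of_posSemidef_mem {V : Submodule ℂ Mat2} (hV : ∀ M : Mat2, M.PosSemidef → M ∈ V)
    (M : Mat2) : M ∈ V := by
  have hherm : ∀ M : Mat2, M.IsHermitian → M ∈ V := by
    intro M hM
    obtain ⟨t, v, rfl⟩ := exists_eq_herm hM
    have h1 := hV _ (posSemidef_herm_iff.mpr (le_refl ‖v‖))
    have h2 := V.smul_mem ((t - ‖v‖ : ℝ) : ℂ) (hV 1 PosSemidef.one)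
    have h3 := V.add_mem h1 h2
    convert h3 using 1
    rw [coe_smul, herm, herm]
    module
  have h := V.add_mem (hherm _ (realPart M).2)
    (V.smul_mem I (hherm _ (imaginaryPart M).2))
  rwa [realPart_add_I_smul_imaginaryPart] at h

/-- The largest eigenvalue is at most `2 * t`; dividing by `2 * t + 1` also covers `M = 0`. -/
theorem exists_smul_effect {M : Mat2} (hM : M.PosSemidef) :
    ∃ s : ℝ, 0 < s ∧ Steering.IsPOVM ![s • M, 1 - s • M] := by
  obtain ⟨t, v, rfl, hv⟩ := exists_herm_of_posSemidef hM
  have ht : 0 ≤ t := (norm_nonneg v).trans hv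
  have hs : 0 < (2 * t + 1)⁻¹ := by positivity
  refine ⟨(2 * t + 1)⁻¹, hs, fun a => ?_, by simp⟩
  fin_cases a
  · exact hM.smul hs.le
  · have : (1 : Mat2) - (2 * t + 1)⁻¹ • herm t v =
        herm (1 - (2 * t + 1)⁻¹ * t) (-((2 * t + 1)⁻¹ • v)) := by
      simp only [herm, map_neg, map_smul]
      module
    change (1 - (2 * t + 1)⁻¹ • herm t v).PosSemidef
    rw [this, posSemidef_herm_iff, norm_neg, norm_smul, Real.norm_of_nonneg hs.le]
    have h1 : (2 * t + 1)⁻¹ * ‖v‖ ≤ (2 * t + 1)⁻¹ * t := by gcongr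
    have h2 : (2 * t + 1)⁻¹ * (2 * t + 1) = 1 := inv_mul_cancel₀ (by positivity)
    nlinarith

theorem steered_smul (ρ : Mat22) (s : ℝ) (M : Mat2) :
    Steering.steered ρ (s • M) = s • Steering.steered ρ M := by
  simp only [steered_eq_sum_block, Finset.smul_sum, Matrix.smul_apply, smul_assoc]

/-- Under simulability, finitely many hidden states generate a cone that contains everything Bob can
be steered to. -/
theorem exists_hidden_states {ρ : Mat22} {n : ℕ} (h : Steering.Simulable ρ n) :
    ∃ τ : Fin n → Mat2, (∀ i, (τ i).PosSemidef) ∧ ∀ M : Mat2, M.PosSemidef →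
      ∃ c : Fin n → ℝ, (∀ i, 0 ≤ c i) ∧ Steering.steered ρ M = ∑ i, c i • τ i := by
  -- All two-outcome POVMs serve as inputs at once, so that one set of hidden states serves every
  -- effect.
  obtain ⟨p, τ, q, hp, -, hτ, hq, -, hσ⟩ := h {M : Fin 2 → Mat2 // Steering.IsPOVM M} (fun _ => 2)
    (fun x a => Steering.steered ρ (x.1 a)) ⟨fun x => x.1, fun x => x.2, fun _ _ => rfl⟩
  refine ⟨τ, fun i => (hτ i).posSemidef, fun M hM => ?_⟩
  obtain ⟨s, hs, hE⟩ := exists_smul_effect hM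
  refine ⟨fun i => s⁻¹ * (q ⟨_, hE⟩ i 0 * p i),
    fun i => mul_nonneg (inv_nonneg.mpr hs.le) (mul_nonneg (hq _ _ _) (hp i).le), ?_⟩
  have h1 := hσ ⟨_, hE⟩ 0
  have h2 : Steering.steered ρ (s • M) = ∑ i, (q ⟨_, hE⟩ i 0 * p i) • τ i := h1
  rw [steered_smul] at h2
  simp only [mul_smul s⁻¹, ← Finset.smul_sum]
  rw [← h2, smul_smul, inv_mul_cancel₀ hs.ne', one_smul]

/-- Bob's blocks lie in every complex subspace that contains all of his steered states. -/
theorem block_mem {ρ : Mat22} {V : Submodule ℂ Mat2}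
    (hV : ∀ M : Mat2, M.PosSemidef → Steering.steered ρ M ∈ V) (a a' : Fin 2) :
    block ρ a a' ∈ V := by
  let L : Mat2 →ₗ[ℂ] Mat2 :=
    { toFun := fun M => ∑ a, ∑ a', M a a' • block ρ a' a
      map_add' := fun M N => by simp only [Matrix.add_apply, add_smul, Finset.sum_add_distrib]
      map_smul' := fun c M => by
        simp only [Matrix.smul_apply, smul_assoc, Finset.smul_sum, RingHom.id_apply] }
  have h := mem_of_posSemidef_mem (V := V.comap L)
    (fun M hM => by
      rw [Submodule.mem_comap]
      change ∑ a, ∑ a', M a a' • block ρ a' a ∈ V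
      rw [← steered_eq_sum_block]
      exact hV M hM) (Matrix.single a' a 1)
  rw [Submodule.mem_comap] at h
  convert h using 1
  change _ = ∑ i, ∑ j, (Matrix.single a' a (1 : ℂ)) i j • block ρ j i
  fin_cases a <;> fin_cases a' <;> simp [Fin.sum_univ_two, Matrix.single_apply]

/-- Over `ℂ` a real quadratic form forces Hermiticity, which is not evident for the coordinate
matrices in `fourTerm_of_basis`. -/
theorem posSemidef_of_forall_nonneg {M : Mat2} (h : ∀ v : Fin 2 → ℂ, 0 ≤ star v ⬝ᵥ (M *ᵥ v)) :
    M.PosSemidef := by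
  rw [← Matrix.isPositive_toEuclideanLin_iff, LinearMap.isPositive_iff_complex]
  intro x
  have hx : inner ℂ (Matrix.toEuclideanLin M x) x = star (star x.ofLp ⬝ᵥ (M *ᵥ x.ofLp)) := by
    rw [← inner_conj_symm]
    simp [EuclideanSpace.inner_eq_star_dotProduct, dotProduct_comm]
  have h1 := Complex.le_def.mp (h x.ofLp)
  rw [hx]
  generalize star x.ofLp ⬝ᵥ (M *ᵥ x.ofLp) = z at h1
  refine ⟨?_, ?_⟩
  · apply Complex.ext
    · simp
    · simpa using h1.2.symm
  · simpa using h1.1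

/-- If the hidden states form a basis, then the coordinates of the steered states are given by
positive operators of Alice, which yields a decomposition into products. -/
theorem fourTerm_of_basis {ρ : Mat22} {n : ℕ} (b : Module.Basis (Fin n) ℂ Mat2)
    (hb : ∀ i, (b i).PosSemidef)
    (h : ∀ M : Mat2, M.PosSemidef →
      ∃ c : Fin n → ℝ, (∀ i, 0 ≤ c i) ∧ Steering.steered ρ M = ∑ i, c i • b i) :
    FourTerm ρ := by
  have key := fourTerm_sum (ω := fun i => Matrix.of fun a a' => b.repr (block ρ a a') i) (β := b)
    (fun i => posSemidef_of_forall_nonneg fun v => ?_) hb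
  · convert key using 1
    ext ⟨a, c⟩ ⟨a', c'⟩
    have := congrFun (congrFun (b.sum_repr (block ρ a a')) c) c'
    rw [Matrix.sum_apply] at this ⊢
    exact this.symm
  -- The quadratic form at `v` is the `i`-th coordinate of the state steered by the rank-one effect
  -- of `v`.
  · obtain ⟨c, hc, hs⟩ := h _ (posSemidef_vecMulVec_self_star v)
    have h1 : b.repr (Steering.steered ρ (vecMulVec v (star v))) i = c i := by
      rw [hs]
      have : ∑ i, c i • b i = ∑ i, (c i : ℂ) • b i := rfl
      rw [this, b.repr_sum_self]
    have h2 : star v ⬝ᵥ ((Matrix.of fun a a' => b.repr (block ρ a a') i) *ᵥ v) = c i := by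
      rw [← h1, steered_eq_sum_block]
      simp [dotProduct, mulVec, Fin.sum_univ_two, vecMulVec_apply]
      ring
    rw [h2]
    exact_mod_cast hc i

/-- If the blocks lie in a proper complex subspace, they are orthogonal to a Hermitian matrix. -/
theorem exists_hermitian_orthogonal {ρ : Mat22} (hρ : ρ.IsHermitian) {V : Submodule ℂ Mat2}
    (hV : V < ⊤) (h : ∀ a a', block ρ a a' ∈ V) :
    ∃ H : Mat2, H.IsHermitian ∧ H ≠ 0 ∧ ∀ a a', (H * block ρ a a').trace = 0 := by
  obtain ⟨f, hf0, hf⟩ := V.exists_le_ker_of_lt_top hV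
  set G : Mat2 := Matrix.of fun j i => f (Matrix.single i j 1) with hG
  have hfG : ∀ M, f M = (G * M).trace := by
    intro M
    conv_lhs => rw [Matrix.matrix_eq_sum_single M]
    have : ∀ i j, Matrix.single i j (M i j) = M i j • Matrix.single i j (1 : ℂ) := by simp
    simp only [this, map_sum, map_smul]
    simp [hG, Matrix.trace, Matrix.mul_apply, Fin.sum_univ_two]
    ring
  have hG1 : ∀ a a', (G * block ρ a a').trace = 0 := fun a a' => by
    rw [← hfG]
    exact hf (h a a')
  have hG2 : ∀ a a', (Gᴴ * block ρ a a').trace = 0 := fun a a' => by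
    rw [← conjTranspose_block hρ, ← conjTranspose_mul, trace_conjTranspose, trace_mul_comm, hG1,
      star_zero]
  have hG0 : G ≠ 0 := fun h0 => hf0 (by ext1 M; simp [hfG, h0])
  -- Both `G` and `Gᴴ` annihilate the blocks; if the Hermitian part vanishes, `I • G` is Hermitian.
  by_cases hre : G + Gᴴ = 0
  · refine ⟨I • G, ?_, by simpa using hG0, fun a a' => by simp [hG1]⟩
    rw [IsHermitian, conjTranspose_smul, eq_neg_of_add_eq_zero_right hre]
    simp
  · exact ⟨G + Gᴴ, isHermitian_add_transpose_self G, hre, fun a a' => by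
      rw [add_mul, trace_add, hG1, hG2, add_zero]⟩

/-- Four is the dimension of `Mat2`: at most four hidden states either form a basis or span a proper
subspace that contains all blocks. -/
theorem fourTerm_of_simulable {ρ : Mat22} (hρ : ρ.PosSemidef) {n : ℕ} (hn : n ≤ 4)
    (h : Steering.Simulable ρ n) : FourTerm ρ := by
  obtain ⟨τ, hτ, hc⟩ := exists_hidden_states h
  rcases (le_top : Submodule.span ℂ (Set.range τ) ≤ ⊤).eq_or_lt with htop | hlt
  · have hli : LinearIndependent ℂ τ :=
      linearIndependent_of_top_le_span_of_card_le_finrank htop.ge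
        (by simpa [Module.finrank_matrix] using hn)
    refine fourTerm_of_basis (Module.Basis.mk hli htop.ge) (fun i => ?_) fun M hM => ?_
    · simpa using hτ i
    · simpa using hc M hM
  · obtain ⟨H, hH, hH0, htr⟩ := exists_hermitian_orthogonal hρ.isHermitian hlt
      (block_mem fun M hM => by
        obtain ⟨c, -, hs⟩ := hc M hM
        rw [hs]
        exact Submodule.sum_mem _ fun i _ =>
          Submodule.smul_mem _ (c i : ℂ) (Submodule.subset_span ⟨i, rfl⟩))
    exact fourTerm_of_trace_block_eq_zero hρ hH hH0 htr

end TwoQubit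

theorem proposition5 (ρ : Matrix (Fin 2 × Fin 2) (Fin 2 × Fin 2) ℂ)
    (hρ : Steering.IsState ρ) :
    Steering.IsEntangled ρ ↔ 4 < Steering.simulationCost ρ := by
  -- If no `n ≤ 4` is admissible, the infimum ranges over `n ≥ 5`; monotonicity of simulability in
  -- `n` is not needed.
  have hcost : Steering.simulationCost ρ ≤ 4 ↔ ∃ n ≤ 4, Steering.Simulable ρ n := by
    constructor
    · intro h
      by_contra! hno
      have h5 : (5 : ℕ∞) ≤ Steering.simulationCost ρ := by
        refine le_iInf₂ fun n hn => ?_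
        have : 5 ≤ n := by
          by_contra! hlt
          exact hno n (by omega) hn
        exact_mod_cast this
      exact absurd (h5.trans h) (by decide)
    · rintro ⟨n, hn, hsim⟩
      refine (iInf₂_le n hsim).trans ?_
      exact_mod_cast hn
  rw [← not_le, hcost, Steering.IsEntangled, and_iff_right hρ, not_iff_not]
  constructor
  · intro h
    exact (TwoQubit.fourTerm_of_isSeparable h).exists_simulable hρ.trace_eq_one
  · rintro ⟨n, hn, hsim⟩
    exact (TwoQubit.fourTerm_of_simulable hρ.posSemidef hn hsim).isSeparable hρ.trace_eq_one
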